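/- Let $n\ge 3$ be an integer. Let $\mathcal C_3=\{(t,t^2,t^3)\mid -1\le t\le 1\}\subseteq\mathbb R^3$ and let $\mathcal A_{3,n}=\mathcal C_3+\dots+\mathcal C_3$ be the Minkowski sum of $n$ copies of $\mathcal C_3$. For integers $k,\ell\ge 1$ and $a,b\ge 0$ put \[ \mathcal C^+_{k,a}=\{k(s,s^2,s^3)+(t,t^2,t^3)\mid -1\le s\le t\le 1\}+a(1,1,1), \] \[ \mathcal C^-_{\ell,b}=\{(s,s^2,s^3)+\ell(t,t^2,t^3)\mid -1\le s\le t\le 1\}+b(-1,1,-1), \] and let $\mathcal B^+_n=\bigcup_{k=1}^{n-1}\mathcal C^+_{k,n-k-1}$ and $\mathcal B^-_n=\bigcup_{\ell=1}^{n-1}\mathcal C^-_{\ell,n-\ell-1}$. Let $\mathcal B^\flat_n$ be the set of all $(x,y)\in\mathbb R^2$ such that $-n\le x\le n$, $ny\ge x^2$ and $y\le n-1+(x+2i-(n-1))^2$ for each $i\in\{0,\dots,n-1\}$. Let $\pi\colon\mathbb R^3\to\mathbb R^2$ be the projection $(x,y,z)\mapsto(x,y)$. Then the following hold. (a) The boundary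 of $\mathcal A_{3,n}$ is $\mathcal B^+_n\cup\mathcal B^-_n$. (b) $\pi(\mathcal B^+_n)=\pi(\mathcal B^-_n)=\mathcal B^\flat_n$. (c) For each $(x,y)\in\mathcal B^\flat_n$ there exist unique numbers $z^+,z^-\in\mathbb R$ such that $(x,y,z^+)\in\mathcal B^+_n$ and $(x,y,z^-)\in\mathcal B^-_n$. We have $z^+\ge z^-$, and equality holds precisely when $(x,y)$ lies on the boundary of $\mathcal B^\flat_n$ in $\mathbb R^2$. (d) For each $(x,y)\in\mathcal B^\flat_n$, with $z^+,z^-$ as in (c), and each $z\in\mathbb R$, we have $(x,y,z)\in\mathcal A_{3,n}$ if and only if $z^+\ge z\ge z^-$. (e) Every point $p$ on the boundary of $\mathcal A_{3,n}$ can be written as $p=\sum_{i=1}^n(t_i,t_i^2,t_i^3)$ for some tuple $(t_1,\dots,t_n)\in[-1,1]^n$. The set $\{t_1,\dots,t_n\}\setminus\{-1,1\}$ has at most two elements, and the tuple $(t_1,\dots,t_n)\in[-1,1]^n$ is unique up to permutation of its entries. -/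

import Mathlib

open scoped Pointwise

namespace MomentCurve

/-- The point `(t, t², t³)` of the cubic moment curve. -/
def cubic (t : ℝ) : ℝ × ℝ × ℝ := (t, t ^ 2, t ^ 3)

/-- The curve segment `{(t, t², t³) | -1 ≤ t ≤ 1}`. -/
def curveSegment : Set (ℝ × ℝ × ℝ) := cubic '' Set.Icc (-1) 1

/-- The Minkowski sum of `n` copies of the curve segment. -/
noncomputable def A (n : ℕ) : Set (ℝ × ℝ × ℝ) := ∑ _i : Fin n, curveSegment

/-- The ridge `{k (s, s², s³) + (t, t², t³) | -1 ≤ s ≤ t ≤ 1} + a (1, 1, 1)`. -/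
def upperRidge (k a : ℕ) : Set (ℝ × ℝ × ℝ) :=
  {p | ∃ s t : ℝ, -1 ≤ s ∧ s ≤ t ∧ t ≤ 1 ∧
    p = (k : ℝ) • cubic s + cubic t + (a : ℝ) • ((1, 1, 1) : ℝ × ℝ × ℝ)}

/-- The ridge `{(s, s², s³) + l (t, t², t³) | -1 ≤ s ≤ t ≤ 1} + b (-1, 1, -1)`. -/
def lowerRidge (l b : ℕ) : Set (ℝ × ℝ × ℝ) :=
  {p | ∃ s t : ℝ, -1 ≤ s ∧ s ≤ t ∧ t ≤ 1 ∧
    p = cubic s + (l : ℝ) • cubic t + (b : ℝ) • ((-1, 1, -1) : ℝ × ℝ × ℝ)}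

/-- The upper shell: the union of the upper ridges with parameters `k, n - k - 1`
for `1 ≤ k ≤ n - 1`. -/
def upperShell (n : ℕ) : Set (ℝ × ℝ × ℝ) :=
  ⋃ k ∈ Finset.Icc 1 (n - 1), upperRidge k (n - k - 1)

/-- The lower shell: the union of the lower ridges with parameters `l, n - l - 1`
for `1 ≤ l ≤ n - 1`. -/
def lowerShell (n : ℕ) : Set (ℝ × ℝ × ℝ) :=
  ⋃ l ∈ Finset.Icc 1 (n - 1), lowerRidge l (n - l - 1)

/-- The planar region of all `(x, y)` with `-n ≤ x ≤ n`, `x² ≤ n y` and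
`y ≤ n - 1 + (x + 2 i - (n - 1))²` for `i = 0, …, n - 1`. The bound on `x` is needed: without it
the other inequalities also have (an unbounded set of) solutions with `|x| > n`. -/
def flatRegion (n : ℕ) : Set (ℝ × ℝ) :=
  {q | -(n : ℝ) ≤ q.1 ∧ q.1 ≤ n ∧ q.1 ^ 2 ≤ n * q.2 ∧
    ∀ i ∈ Finset.range n, q.2 ≤ (n : ℝ) - 1 + (q.1 + 2 * (i : ℝ) - ((n : ℝ) - 1)) ^ 2}

/-- The projection `(x, y, z) ↦ (x, y)`. -/
def proj (p : ℝ × ℝ × ℝ) : ℝ × ℝ := (p.1, p.2.1)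

end MomentCurve

/-!
Points of `A n` are the triples of the first three power sums of tuples in `[-1, 1]^n`. The proof
fixes the first two power sums `(x, y)` and studies the third one along the fibre.

The pairs `(x, y)` that occur are exactly those of `flatRegion n`. The lower bound on `y` is the
Cauchy–Schwarz inequality. The upper bounds hold because `∑ tᵢ² - (x - c)²` is affine in each `tᵢ`
(`sum_sq_le_of_odd`). Conversely a segment in the cube from a constant tuple to a tuple with all but
one entry `±1` realizes all `y` between the bounds (`exists_represents`).

If three entries satisfy `a < b ≤ c < 1`, lowering the constant term of `(X - a) (X - b) (X - c)`
moves the roots so that the first two power sums stay and the third one grows, by any sufficiently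
small amount (`exists_raised_triple`). Tuples without such entries (`IsUpper`) are, once sorted, of
the form `(s, …, s, u, 1, …, 1)`; they are the points of the upper shell, and among them the first
two power sums determine the tuple (`upperTuple_unique`). By compactness each fibre has a highest
point, which is therefore the only point of the upper shell in the fibre, and the fibre has no gaps
below it. The symmetry `t ↦ -t` transfers all of this to the lower shell, so that the fibre is the
interval between the two shells (`mem_A_iff_of_mem_shells`).

The interval degenerates precisely when one tuple is extreme in both directions, hence is constant
or has all but one entry `±1`, which means that one of the inequalities for `(x, y)` is an equality
(`shells_eq_iff_isTight`, `mem_frontier_flatRegion_iff`). Compactness of the shells shows that the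
points strictly between them are interior (`mem_interior_A`), which gives the boundary of `A n`.
-/

namespace MomentCurve

open Set

/-! ### Tuples and their power sums -/

/-- The tuple `t` has entries in `[-1, 1]` and its first three power sums are `x`, `y`, `z`. -/
def Represents {n : ℕ} (t : Fin n → ℝ) (x y z : ℝ) : Prop :=
  (∀ i, t i ∈ Icc (-1 : ℝ) 1) ∧ ∑ i, t i = x ∧ ∑ i, t i ^ 2 = y ∧ ∑ i, t i ^ 3 = z

theorem sum_cubic_eq {n : ℕ} (t : Fin n → ℝ) :
    ∑ i, cubic (t i) = (∑ i, t i, ∑ i, t i ^ 2, ∑ i, t i ^ 3) := by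
  simp only [cubic, Prod.ext_iff, Prod.fst_sum, Prod.snd_sum, and_self]

theorem represents_iff {n : ℕ} {t : Fin n → ℝ} {x y z : ℝ} :
    Represents t x y z ↔ (∀ i, t i ∈ Icc (-1 : ℝ) 1) ∧ (x, y, z) = ∑ i, cubic (t i) := by
  rw [sum_cubic_eq, Prod.ext_iff, Prod.ext_iff, Represents]
  simp only [eq_comm]

theorem A_eq_image (n : ℕ) :
    A n = (fun t : Fin n → ℝ => ∑ i, cubic (t i)) '' univ.pi fun _ => Icc (-1 : ℝ) 1 := by
  ext p
  simp only [A, curveSegment, Set.mem_fintype_sum, mem_image, mem_univ_pi]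
  constructor
  · rintro ⟨g, hg, rfl⟩
    choose t ht htg using hg
    exact ⟨t, ht, by simp only [htg]⟩
  · rintro ⟨t, ht, rfl⟩
    exact ⟨fun i => cubic (t i), fun i => ⟨t i, ht i, rfl⟩, rfl⟩

theorem mem_A_iff {n : ℕ} {x y z : ℝ} :
    (x, y, z) ∈ A n ↔ ∃ t : Fin n → ℝ, Represents t x y z := by
  simp only [A_eq_image, represents_iff, mem_image, mem_univ_pi, eq_comm]

theorem continuous_cubic : Continuous cubic := by
  unfold cubic; fun_prop

theorem isCompact_A (n : ℕ) : IsCompact (A n) := by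
  rw [A_eq_image]
  refine (isCompact_univ_pi fun _ => isCompact_Icc).image ?_
  have := continuous_cubic
  fun_prop

theorem Represents.neg {n : ℕ} {t : Fin n → ℝ} {x y z : ℝ} (h : Represents t x y z) :
    Represents (-t) (-x) y (-z) := by
  obtain ⟨h0, rfl, rfl, rfl⟩ := h
  refine ⟨fun i => ⟨?_, ?_⟩, ?_, ?_, ?_⟩
  · simpa using (h0 i).2
  · have := (h0 i).1
    simp only [Pi.neg_apply]; linarith
  · simp
  · simp
  · simp [Odd.neg_pow (by decide : Odd 3)]

theorem Represents.comp_perm {n : ℕ} {t : Fin n → ℝ} {x y z : ℝ} (h : Represents t x y z)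
    (σ : Equiv.Perm (Fin n)) : Represents (t ∘ σ) x y z := by
  obtain ⟨h0, rfl, rfl, rfl⟩ := h
  exact ⟨fun i => h0 (σ i), Equiv.sum_comp σ t, Equiv.sum_comp σ fun i => t i ^ 2,
    Equiv.sum_comp σ fun i => t i ^ 3⟩

theorem neg_mem_A_iff {n : ℕ} {x y z : ℝ} : (-x, y, -z) ∈ A n ↔ (x, y, z) ∈ A n := by
  simp only [mem_A_iff]
  constructor
  · rintro ⟨t, ht⟩
    exact ⟨-t, by simpa using ht.neg⟩
  · rintro ⟨t, ht⟩
    exact ⟨-t, ht.neg⟩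

/-! ### The planar region of the first two power sums -/

/-- With `x = ∑ tᵢ`, the function `∑ tᵢ² - (x - c)²` is affine in each `tᵢ`, so on the cube it is
largest at a vertex, where `x - c` is an odd integer. -/
theorem sum_sq_le_of_odd {n : ℕ} (t : Fin n → ℝ) (ht : ∀ i, t i ∈ Icc (-1 : ℝ) 1) (c : ℤ)
    (hc : Odd (c + n)) : ∑ i, t i ^ 2 ≤ (n : ℝ) - 1 + (∑ i, t i - c) ^ 2 := by
  induction n generalizing c with
  | zero =>
    have h1 : (1 : ℤ) ≤ c ^ 2 := by
      have : c ≠ 0 := by rintro rfl; simp at hc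
      nlinarith [Int.one_le_abs this, sq_abs c]
    have h2 : (1 : ℝ) ≤ (c : ℝ) ^ 2 := by exact_mod_cast h1
    simpa using h2
  | succ n ih =>
    have h1 := ih (fun i => t i.succ) (fun i => ht _) (c - 1) (by
      have : c - 1 + (n : ℤ) = c + ((n + 1 : ℕ) : ℤ) - 2 := by push_cast; ring
      rw [this]; exact hc.sub_even even_two)
    have h2 := ih (fun i => t i.succ) (fun i => ht _) (c + 1) (by
      have : c + 1 + (n : ℤ) = c + ((n + 1 : ℕ) : ℤ) := by push_cast; ring
      rwa [this])
    rw [Fin.sum_univ_succ, Fin.sum_univ_succ]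
    push_cast at h1 h2 ⊢
    obtain ⟨h3, h4⟩ := ht 0
    set X := ∑ i : Fin n, t i.succ
    set u := t 0
    -- the value at `u` is the average of the values at `±1` with weights `(1 ± u) / 2`
    nlinarith [mul_le_mul_of_nonneg_left h1 (by linarith : 0 ≤ 1 + u),
      mul_le_mul_of_nonneg_left h2 (by linarith : 0 ≤ 1 - u)]

theorem sum_sq_le {n : ℕ} (t : Fin n → ℝ) (ht : ∀ i, t i ∈ Icc (-1 : ℝ) 1) (i : ℕ) :
    ∑ j, t j ^ 2 ≤ (n : ℝ) - 1 + (∑ j, t j + 2 * (i : ℝ) - ((n : ℝ) - 1)) ^ 2 := by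
  have h := sum_sq_le_of_odd t ht ((n : ℤ) - 1 - 2 * i) ⟨(n : ℤ) - 1 - i, by ring⟩
  push_cast at h
  convert h using 3
  ring

theorem sq_sum_le {n : ℕ} (t : Fin n → ℝ) : (∑ i, t i) ^ 2 ≤ n * ∑ i, t i ^ 2 := by
  simpa using sq_sum_le_card_mul_sum_sq (s := Finset.univ) (f := t)

theorem Represents.mem_flatRegion {n : ℕ} {t : Fin n → ℝ} {x y z : ℝ} (h : Represents t x y z) :
    (x, y) ∈ flatRegion n := by
  obtain ⟨h0, rfl, rfl, rfl⟩ := h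
  refine ⟨?_, ?_, sq_sum_le t, fun i _ => sum_sq_le t h0 i⟩
  · have := Finset.sum_le_sum fun i (_ : i ∈ Finset.univ) => (h0 i).1
    simpa using this
  · have := Finset.sum_le_sum fun i (_ : i ∈ Finset.univ) => (h0 i).2
    simpa using this

theorem sum_step {n k : ℕ} (hk : k < n) (a b c : ℝ) :
    ∑ i : Fin n, (if (i : ℕ) < k then a else if (i : ℕ) = k then b else c) =
      k * a + b + ((n - k - 1 : ℕ) : ℝ) * c := by
  rw [Fin.sum_univ_eq_sum_range (fun i => if i < k then a else if i = k then b else c) n]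
  obtain ⟨m, rfl⟩ : ∃ m, n = k + 1 + m := ⟨n - k - 1, by omega⟩
  rw [Finset.sum_range_add, Finset.sum_range_succ]
  have h1 : ∑ i ∈ Finset.range k, (if i < k then a else if i = k then b else c) = k * a := by
    rw [Finset.sum_congr rfl fun i hi => if_pos (Finset.mem_range.1 hi)]
    simp
  have h2 : ∑ i ∈ Finset.range m, (if k + 1 + i < k then a else if k + 1 + i = k then b else c) =
      m * c := by
    rw [Finset.sum_congr rfl fun i _ =>
      (if_neg (by omega : ¬ k + 1 + i < k)).trans (if_neg (by omega : ¬ k + 1 + i = k))]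
    simp
  rw [h1, h2]
  simp [show k + 1 + m - k - 1 = m by omega]

/-- Every `x ∈ [-n, n]` is the sum of a tuple with entries `-1` (`i` times), `1` (`n - 1 - i` times)
and one remaining entry in `[-1, 1]`. -/
theorem exists_remainder {n : ℕ} (hn : 1 ≤ n) {x : ℝ} (h1 : -(n : ℝ) ≤ x) (h2 : x ≤ n) :
    ∃ i < n, x + 2 * (i : ℝ) - ((n : ℝ) - 1) ∈ Icc (-1 : ℝ) 1 := by
  rcases h1.eq_or_lt with rfl | h1
  · refine ⟨n - 1, by omega, ?_⟩
    rw [Nat.cast_sub hn]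
    constructor <;> push_cast <;> linarith
  · have h3 : 0 ≤ ((n : ℝ) - x) / 2 := by linarith
    have h4 := Nat.floor_le h3
    have h5 := Nat.lt_floor_add_one (((n : ℝ) - x) / 2)
    refine ⟨⌊((n : ℝ) - x) / 2⌋₊, ?_, ?_, ?_⟩
    · rw [Nat.floor_lt h3]; linarith
    · linarith
    · linarith

/-- Every point of the planar region is realized: along the segment from a constant tuple to a tuple
with all but one entry equal to `±1`, the sum of squares takes every value in between. -/
theorem exists_represents {n : ℕ} (hn : 1 ≤ n) {x y : ℝ} (h : (x, y) ∈ flatRegion n) :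
    ∃ (t : Fin n → ℝ) (z : ℝ), Represents t x y z := by
  obtain ⟨h1, h2, h3, h4⟩ := h
  simp only at h1 h2 h3 h4
  obtain ⟨i, hi, hu⟩ := exists_remainder hn h1 h2
  have h5 := h4 i (Finset.mem_range.2 hi)
  set u := x + 2 * (i : ℝ) - ((n : ℝ) - 1) with hudef
  have hn0 : (0 : ℝ) < n := by exact_mod_cast hn
  have hn1 : (((n - i - 1 : ℕ)) : ℝ) = n - i - 1 := by
    rw [Nat.sub_sub, Nat.cast_sub (by omega)]; push_cast; ring
  let v : Fin n → ℝ := fun j => if (j : ℕ) < i then -1 else if (j : ℕ) = i then u else 1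
  have hv0 : ∀ j, v j ∈ Icc (-1 : ℝ) 1 := by
    intro j
    simp only [v]
    split_ifs
    · simp
    · exact hu
    · simp
  have hv1 : ∑ j, v j = x := by
    rw [sum_step hi, hn1, hudef]; ring
  have hv2 : ∑ j, v j ^ 2 = n - 1 + u ^ 2 := by
    have : ∀ j, v j ^ 2 =
        if (j : ℕ) < i then (-1) ^ 2 else if (j : ℕ) = i then u ^ 2 else 1 ^ 2 := by
      intro j; simp only [v]; split_ifs <;> rfl
    simp only [this]
    rw [sum_step hi, hn1]; ring
  let w : ℝ → Fin n → ℝ := fun r j => (1 - r) * (x / n) + r * v j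
  have hxn : x / n ∈ Icc (-1 : ℝ) 1 :=
    ⟨by rw [le_div_iff₀ hn0]; linarith, by rw [div_le_iff₀ hn0]; linarith⟩
  have hcont : ContinuousOn (fun r => ∑ j, w r j ^ 2) (Icc 0 1) := by
    simp only [w]; fun_prop
  obtain ⟨r, hr, hry⟩ := intermediate_value_Icc zero_le_one hcont (show y ∈ Icc _ _ by
    constructor
    · have : ∑ j, w 0 j ^ 2 = x ^ 2 / n := by
        simp [w]; field_simp
      simp only [this]
      rw [div_le_iff₀ hn0]; linarith
    · simpa [w, hv2] using h5)
  refine ⟨w r, _, fun j => ?_, ?_, hry, rfl⟩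
  · exact convex_Icc (-1 : ℝ) 1 hxn (hv0 j) (by linarith [hr.2]) hr.1 (by ring)
  · simp only [w, Finset.sum_add_distrib, ← Finset.mul_sum, hv1]
    simp; field_simp; ring

theorem neg_mem_flatRegion {n : ℕ} (hn : 1 ≤ n) {x y : ℝ} (h : (x, y) ∈ flatRegion n) :
    (-x, y) ∈ flatRegion n := by
  obtain ⟨t, z, ht⟩ := exists_represents hn h
  exact ht.neg.mem_flatRegion

/-! ### Raising the third power sum of three entries -/

/-- Lowering the cubic with roots `a < b ≤ c < 1` by a small constant `ε` moves the roots to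
`a < a' < b' < b` and `c < c' ≤ 1`. The first two power sums of the roots are kept, and the third
one grows by `3 * ε`. -/
theorem exists_raised_triple {a b c : ℝ} (ha : -1 ≤ a) (hab : a < b) (hbc : b ≤ c) (hc : c < 1) :
    ∃ ε₀ > 0, ∀ ε, 0 < ε → ε ≤ ε₀ → ∃ a' b' c' : ℝ,
      a' ∈ Icc (-1 : ℝ) 1 ∧ b' ∈ Icc (-1 : ℝ) 1 ∧ c' ∈ Icc (-1 : ℝ) 1 ∧
      a' + b' + c' = a + b + c ∧ a' ^ 2 + b' ^ 2 + c' ^ 2 = a ^ 2 + b ^ 2 + c ^ 2 ∧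
      a' ^ 3 + b' ^ 3 + c' ^ 3 = a ^ 3 + b ^ 3 + c ^ 3 + 3 * ε := by
  let f : ℝ → ℝ := fun X => (X - a) * (X - b) * (X - c)
  have hf : Continuous f := by simp only [f]; fun_prop
  let m := (a + b) / 2
  have ham : a < m := by simp only [m]; linarith
  have hmb : m < b := by simp only [m]; linarith
  have hm : 0 < f m := mul_pos_of_neg_of_neg
    (mul_neg_of_pos_of_neg (by linarith) (by linarith)) (by linarith)
  have h1 : 0 < f 1 := mul_pos (mul_pos (by linarith) (by linarith)) (by linarith)
  have hfa : f a = 0 := by simp [f]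
  have hfb : f b = 0 := by simp [f]
  have hfc : f c = 0 := by simp [f]
  refine ⟨min (f m) (f 1) / 2, by positivity, fun ε hε hε' => ?_⟩
  have hεm : ε < f m := by linarith [min_le_left (f m) (f 1)]
  have hε1 : ε < f 1 := by linarith [min_le_right (f m) (f 1)]
  obtain ⟨a', ⟨ha1, ha2⟩, ha3⟩ := intermediate_value_Ioo ham.le hf.continuousOn
    (show ε ∈ Ioo (f a) (f m) from ⟨by rwa [hfa], hεm⟩)
  obtain ⟨b', ⟨hb1, hb2⟩, hb3⟩ := intermediate_value_Ioo' hmb.le hf.continuousOn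
    (show ε ∈ Ioo (f b) (f m) from ⟨by rwa [hfb], hεm⟩)
  obtain ⟨c', ⟨hc1, hc2⟩, hc3⟩ := intermediate_value_Ioo hc.le hf.continuousOn
    (show ε ∈ Ioo (f c) (f 1) from ⟨by rwa [hfc], hε1⟩)
  simp only [f] at ha3 hb3 hc3
  -- divided differences of the cubic at its three distinct roots give Vieta's formulas
  have hab' : a' - b' ≠ 0 := by linarith
  have hac' : a' - c' ≠ 0 := by linarith
  have hbc' : b' - c' ≠ 0 := by linarith
  have d1 : a' ^ 2 + a' * b' + b' ^ 2 - (a + b + c) * (a' + b') + (a * b + a * c + b * c) = 0 := by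
    apply mul_left_cancel₀ hab'
    linear_combination ha3 - hb3
  have d2 : a' ^ 2 + a' * c' + c' ^ 2 - (a + b + c) * (a' + c') + (a * b + a * c + b * c) = 0 := by
    apply mul_left_cancel₀ hac'
    linear_combination ha3 - hc3
  have e1 : a' + b' + c' = a + b + c := by
    apply mul_left_cancel₀ hbc'
    linear_combination d1 - d2
  have e2 : a' ^ 2 + b' ^ 2 + c' ^ 2 = a ^ 2 + b ^ 2 + c ^ 2 := by
    obtain rfl : c' = a + b + c - a' - b' := by linarith
    linear_combination 2 * d1
  refine ⟨a', b', c', ⟨by linarith, by linarith⟩, ⟨by linarith, by linarith⟩,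
    ⟨by linarith, hc2.le⟩, e1, e2, ?_⟩
  obtain rfl : c' = a + b + c - a' - b' := by linarith
  linear_combination ha3 + hb3 + hc3 + (a+b+c) * e2

theorem sum_update {n : ℕ} (f : ℝ → ℝ) (t : Fin n → ℝ) (i : Fin n) (a : ℝ) :
    ∑ m, f (Function.update t i a m) = ∑ m, f (t m) + (f a - f (t i)) := by
  rw [← Finset.add_sum_erase _ _ (Finset.mem_univ i), ← Finset.add_sum_erase _ (fun m => f (t m))
    (Finset.mem_univ i), Function.update_self]
  rw [Finset.sum_congr rfl fun m hm => by rw [Function.update_of_ne (Finset.ne_of_mem_erase hm)]]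
  ring

/-- No three entries `a < b ≤ c < 1` occur in `t`. By `exists_raised_triple` this is necessary for
`t` to maximize the third power sum among tuples in the cube with the same first two. -/
def IsUpper {n : ℕ} (t : Fin n → ℝ) : Prop :=
  ∀ i j l, i ≠ j → j ≠ l → i ≠ l → t i < t j → t j ≤ t l → t l = 1

theorem Represents.exists_raise {n : ℕ} {t : Fin n → ℝ} {x y z : ℝ} (h : Represents t x y z)
    (hu : ¬ IsUpper t) : ∃ δ₀ > 0, ∀ δ, 0 < δ → δ ≤ δ₀ → (x, y, z + δ) ∈ A n := by
  obtain ⟨h0, rfl, rfl, rfl⟩ := h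
  simp only [IsUpper, not_forall] at hu
  obtain ⟨i, j, l, hij, hjl, hil, h1, h2, h3⟩ := hu
  obtain ⟨ε₀, hε₀, H⟩ := exists_raised_triple (h0 i).1 h1 h2 (lt_of_le_of_ne (h0 l).2 h3)
  refine ⟨ε₀ * 3, by positivity, fun δ hδ hδ' => ?_⟩
  obtain ⟨a', b', c', ha, hb, hc, e1, e2, e3⟩ := H (δ / 3) (by positivity) (by linarith)
  rw [mem_A_iff]
  have key : ∀ f : ℝ → ℝ, ∑ m, f (Function.update (Function.update (Function.update t i a') j b')
      l c' m) = ∑ m, f (t m) + (f a' - f (t i)) + (f b' - f (t j)) + (f c' - f (t l)) := by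
    intro f
    rw [sum_update, sum_update, sum_update, Function.update_of_ne hjl.symm,
      Function.update_of_ne hil.symm, Function.update_of_ne hij.symm]
  refine ⟨Function.update (Function.update (Function.update t i a') j b') l c', fun m => ?_,
    ?_, ?_, ?_⟩
  · simp only [Function.update_apply]
    split_ifs
    exacts [hc, hb, ha, h0 m]
  · rw [key fun r => r]; linarith
  · rw [key fun r => r ^ 2]; linarith
  · rw [key fun r => r ^ 3]; linarith

/-! ### Tuples of the upper shell -/

/-- The tuple `(s, …, s, u, 1, …, 1)` of length `n` that starts with `k` copies of `s`. -/
def upperTuple (n k : ℕ) (s u : ℝ) : Fin n → ℝ :=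
  fun i => if (i : ℕ) < k then s else if (i : ℕ) = k then u else 1

theorem sum_upperTuple {n k : ℕ} (hk : k < n) (f : ℝ → ℝ) (s u : ℝ) :
    ∑ i, f (upperTuple n k s u i) = k * f s + f u + ((n : ℝ) - k - 1) * f 1 := by
  have h : ∀ i, f (upperTuple n k s u i) =
      if (i : ℕ) < k then f s else if (i : ℕ) = k then f u else f 1 := by
    intro i; simp only [upperTuple]; split_ifs <;> rfl
  simp only [h]
  rw [sum_step hk, Nat.sub_sub, Nat.cast_sub (by omega)]
  push_cast
  ring

theorem upperTuple_represents_iff {n k : ℕ} (hk : k < n) {s u x y z : ℝ} (hs : -1 ≤ s)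
    (hsu : s ≤ u) (hu : u ≤ 1) : Represents (upperTuple n k s u) x y z ↔
      k * s + u + ((n : ℝ) - k - 1) = x ∧ k * s ^ 2 + u ^ 2 + ((n : ℝ) - k - 1) = y ∧
        k * s ^ 3 + u ^ 3 + ((n : ℝ) - k - 1) = z := by
  have h0 : ∀ i, upperTuple n k s u i ∈ Icc (-1 : ℝ) 1 := by
    intro i
    simp only [upperTuple]
    split_ifs
    exacts [⟨hs, hsu.trans hu⟩, ⟨hs.trans hsu, hu⟩, by simp]
  have h1 := sum_upperTuple hk (fun r => r) s u
  have h2 := sum_upperTuple hk (fun r => r ^ 2) s u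
  have h3 := sum_upperTuple hk (fun r => r ^ 3) s u
  simp only [mul_one, one_pow] at h1 h2 h3
  simp only [Represents, h1, h2, h3, h0, implies_true, true_and]

theorem mem_upperShell_iff {n : ℕ} {x y z : ℝ} : (x, y, z) ∈ upperShell n ↔
    ∃ (k : ℕ) (s u : ℝ), 1 ≤ k ∧ k < n ∧ -1 ≤ s ∧ s ≤ u ∧ u ≤ 1 ∧
      Represents (upperTuple n k s u) x y z := by
  simp only [upperShell, mem_iUnion, Finset.mem_Icc, upperRidge, mem_ofPred_eq, exists_prop]
  refine exists_congr fun k => ⟨?_, ?_⟩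
  · rintro ⟨⟨h1, h2⟩, s, u, hs, hsu, hu, h⟩
    refine ⟨s, u, h1, by omega, hs, hsu, hu, ?_⟩
    rw [upperTuple_represents_iff (by omega) hs hsu hu]
    rw [Nat.sub_sub, Nat.cast_sub (by omega)] at h
    simp only [cubic, Prod.ext_iff, Prod.smul_mk, Prod.mk_add_mk, smul_eq_mul, mul_one] at h
    obtain ⟨e1, e2, e3⟩ := h
    push_cast at e1 e2 e3
    exact ⟨by linarith, by linarith, by linarith⟩
  · rintro ⟨s, u, h1, h2, hs, hsu, hu, h⟩
    rw [upperTuple_represents_iff (by omega) hs hsu hu] at h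
    refine ⟨⟨h1, by omega⟩, s, u, hs, hsu, hu, ?_⟩
    rw [Nat.sub_sub, Nat.cast_sub (by omega)]
    simp only [cubic, Prod.ext_iff, Prod.smul_mk, Prod.mk_add_mk, smul_eq_mul, mul_one]
    obtain ⟨e1, e2, e3⟩ := h
    push_cast
    exact ⟨by linarith, by linarith, by linarith⟩

theorem IsUpper.exists_perm {n : ℕ} (hn : 2 ≤ n) {t : Fin n → ℝ} (ht : ∀ i, t i ∈ Icc (-1 : ℝ) 1)
    (h : IsUpper t) : ∃ (σ : Equiv.Perm (Fin n)) (k : ℕ) (s u : ℝ), 1 ≤ k ∧ k < n ∧ -1 ≤ s ∧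
      s ≤ u ∧ u ≤ 1 ∧ t ∘ σ = upperTuple n k s u := by
  classical
  let σ := Tuple.sort t
  have hmono : Monotone (t ∘ σ) := Tuple.monotone_sort t
  let o : Fin n := ⟨0, by omega⟩
  have ho : ∀ i, (t ∘ σ) o ≤ (t ∘ σ) i := fun i => hmono (Fin.mk_le_of_le_val (Nat.zero_le _))
  refine ⟨σ, ?_⟩
  by_cases hex : ∃ j : Fin n, (t ∘ σ) o < (t ∘ σ) j
  · -- `k` is the first index at which the sorted tuple exceeds its smallest entry
    have hex' : ∃ k : ℕ, ∃ hk : k < n, (t ∘ σ) o < (t ∘ σ) ⟨k, hk⟩ :=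
      let ⟨j, hj⟩ := hex; ⟨j, j.2, hj⟩
    obtain ⟨hk, hlt⟩ := Nat.find_spec hex'
    have hmin := fun m => @Nat.find_min _ _ hex' m
    set k := Nat.find hex'
    have hk0 : k ≠ 0 := by
      intro h0
      exact hlt.ne (congrArg (t ∘ σ) (Fin.ext h0.symm))
    refine ⟨k, t (σ o), t (σ ⟨k, hk⟩), by omega, hk, (ht _).1, hlt.le, (ht _).2, ?_⟩
    ext i
    simp only [upperTuple]
    split_ifs with h1 h2
    · have := hmin i h1
      simp only [Fin.eta, not_exists, not_lt] at this
      exact le_antisymm (this i.2) (ho i)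
    · simp [← h2]
    · refine h (σ o) (σ ⟨k, hk⟩) (σ i) ?_ ?_ ?_ hlt (hmono ?_)
      · exact σ.injective.ne (by simp [o, Fin.ext_iff]; omega)
      · exact σ.injective.ne (by simp [Fin.ext_iff]; omega)
      · exact σ.injective.ne (by simp [o, Fin.ext_iff]; omega)
      · rw [Fin.le_def]; simp only; omega
  · push Not at hex
    refine ⟨n - 1, t (σ o), t (σ o), by omega, by omega, (ht _).1, le_rfl, (ht _).2, ?_⟩
    ext i
    simp only [upperTuple]
    split_ifs with h1 h2
    · exact le_antisymm (hex i) (ho i)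
    · exact le_antisymm (hex i) (ho i)
    · omega

/-- Two upper tuples with different numbers `k < k'` of leading entries and equal first two power
sums agree. Their difference changes sign at most once, from negative to positive, at index `k`;
weighting it by `(sum of the two entries) - (u + s')` leaves only nonnegative terms. -/
theorem upperTuple_eq_of_lt {n k k' : ℕ} (hkk : k < k') {s u s' u' : ℝ} (hk : 1 ≤ k)
    (hsu : s ≤ u) (hu : u ≤ 1) (hsu' : s' ≤ u') (hu' : u' ≤ 1)
    (h1 : k * s + u + ((n : ℝ) - k - 1) = k' * s' + u' + ((n : ℝ) - k' - 1))
    (h2 : k * s ^ 2 + u ^ 2 + ((n : ℝ) - k - 1) = k' * s' ^ 2 + u' ^ 2 + ((n : ℝ) - k' - 1)) :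
    upperTuple n k s u = upperTuple n k' s' u' := by
  obtain ⟨d, rfl⟩ : ∃ d, k' = k + 1 + d := ⟨k' - k - 1, by omega⟩
  push_cast at h1 h2
  have hk0 : (1 : ℝ) ≤ k := by exact_mod_cast hk
  have hd0 : (0 : ℝ) ≤ d := Nat.cast_nonneg d
  have hs1 : s' ≤ 1 := hsu'.trans hu'
  have hds : 0 ≤ d * (1 - s') := mul_nonneg hd0 (by linarith)
  have e1 : k * (s - s') + (u - s') + d * (1 - s') + (1 - u') = 0 := by linarith
  have e2 : k * ((s - s') * (s - u)) + d * ((1 - s') * (1 - u)) +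
      (1 - u') * ((1 - u) + (u' - s')) = 0 := by
    linear_combination h2 - (u + s') * h1
  have hss : s ≤ s' := by
    by_contra hlt
    push Not at hlt
    have : 0 < k * (s - s') := mul_pos (by linarith) (by linarith)
    linarith
  have p1 : 0 ≤ (s - s') * (s - u) := mul_nonneg_of_nonpos_of_nonpos (by linarith) (by linarith)
  have p2 : 0 ≤ (1 - s') * (1 - u) := mul_nonneg (by linarith) (by linarith)
  have p3 : 0 ≤ (1 - u') * ((1 - u) + (u' - s')) := mul_nonneg (by linarith) (by linarith)
  have p1' := mul_nonneg (by linarith : (0 : ℝ) ≤ k) p1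
  have p2' := mul_nonneg hd0 p2
  have q1 : (s - s') * (s - u) = 0 := by
    have : k * ((s - s') * (s - u)) = 0 := by linarith
    rcases mul_eq_zero.1 this with h | h
    · linarith
    · exact h
  have q2 : d * ((1 - s') * (1 - u)) = 0 := by linarith
  have q3 : (1 - u') * ((1 - u) + (u' - s')) = 0 := by linarith
  rcases hss.eq_or_lt with rfl | hlt
  · have hus : u = s := by linarith
    have hu1 : u' = 1 := by linarith
    have hd : (d : ℝ) * (1 - s) = 0 := by linarith
    ext i
    simp only [upperTuple, hus, hu1]
    rcases mul_eq_zero.1 hd with h | h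
    · have : d = 0 := by exact_mod_cast h
      subst this
      split_ifs <;> first | rfl | omega
    · obtain rfl : s = 1 := by linarith
      simp
  · exfalso
    have hus : u = s := by
      rcases mul_eq_zero.1 q1 with h | h <;> linarith
    have hu1 : u' = 1 := by
      rcases mul_eq_zero.1 q3 with h | h <;> linarith
    have hd : (d : ℝ) * (1 - s') = 0 := by
      rw [← mul_assoc] at q2
      rcases mul_eq_zero.1 q2 with h | h
      · exact h
      · linarith
    have : (k : ℝ) * (s - s') < 0 := mul_neg_of_pos_of_neg (by linarith) (by linarith)
    linarith

/-- An upper tuple is determined by its first two power sums. -/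
theorem upperTuple_unique {n k k' : ℕ} {s u s' u' x y z z' : ℝ} (hk : 1 ≤ k) (hkn : k < n)
    (hs : -1 ≤ s) (hsu : s ≤ u) (hu : u ≤ 1) (hk' : 1 ≤ k') (hkn' : k' < n)
    (hs' : -1 ≤ s') (hsu' : s' ≤ u') (hu' : u' ≤ 1)
    (h : Represents (upperTuple n k s u) x y z) (h' : Represents (upperTuple n k' s' u') x y z') :
    upperTuple n k s u = upperTuple n k' s' u' := by
  rw [upperTuple_represents_iff hkn hs hsu hu] at h
  rw [upperTuple_represents_iff hkn' hs' hsu' hu'] at h'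
  obtain ⟨a1, a2, -⟩ := h
  obtain ⟨b1, b2, -⟩ := h'
  rcases lt_trichotomy k k' with hlt | rfl | hlt
  · exact upperTuple_eq_of_lt hlt hk hsu hu hsu' hu' (a1.trans b1.symm) (a2.trans b2.symm)
  · have hk0 : (1 : ℝ) ≤ k := by exact_mod_cast hk
    have e1 : k * (s - s') = u' - u := by linarith
    have e2 : (u' - u) * ((s + s') - (u + u')) = 0 := by
      rw [← e1]
      linear_combination a2 - b2 + (u' + u) * (b1 - a1)
    have hss : s = s' := by
      rcases mul_eq_zero.1 e2 with h | h
      · rw [h] at e1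
        rcases mul_eq_zero.1 e1 with h | h <;> linarith
      · have : (k + 1) * (s - s') = 0 := by linarith
        rcases mul_eq_zero.1 this with h | h <;> linarith
    subst hss
    have : u = u' := by linarith
    rw [this]
  · exact (upperTuple_eq_of_lt hlt hk' hsu' hu' hsu hu (b1.trans a1.symm) (b2.trans a2.symm)).symm

/-! ### Vertical fibres -/

theorem upperShell_subset_A (n : ℕ) : upperShell n ⊆ A n := by
  rintro ⟨x, y, z⟩ h
  obtain ⟨k, s, u, -, -, -, -, -, h⟩ := mem_upperShell_iff.1 h
  exact mem_A_iff.2 ⟨_, h⟩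

theorem upperShell_unique {n : ℕ} {x y z z' : ℝ} (h : (x, y, z) ∈ upperShell n)
    (h' : (x, y, z') ∈ upperShell n) : z = z' := by
  obtain ⟨k, s, u, h1, h2, h3, h4, h5, h⟩ := mem_upperShell_iff.1 h
  obtain ⟨k', s', u', h1', h2', h3', h4', h5', h'⟩ := mem_upperShell_iff.1 h'
  have := upperTuple_unique h1 h2 h3 h4 h5 h1' h2' h3' h4' h5' h h'
  rw [← this] at h'
  exact h.2.2.2.symm.trans h'.2.2.2

theorem Represents.mem_upperShell {n : ℕ} (hn : 2 ≤ n) {t : Fin n → ℝ} {x y z : ℝ}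
    (h : Represents t x y z) (hu : IsUpper t) : (x, y, z) ∈ upperShell n := by
  obtain ⟨σ, k, s, u, h1, h2, h3, h4, h5, hσ⟩ := hu.exists_perm hn h.1
  exact mem_upperShell_iff.2 ⟨k, s, u, h1, h2, h3, h4, h5, hσ ▸ h.comp_perm σ⟩

theorem isCompact_fiber (n : ℕ) (x y : ℝ) : IsCompact {z : ℝ | (x, y, z) ∈ A n} := by
  have h : {z : ℝ | (x, y, z) ∈ A n} =
      (fun p : ℝ × ℝ × ℝ => p.2.2) '' (A n ∩ {p | p.1 = x ∧ p.2.1 = y}) := by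
    ext z
    constructor
    · exact fun hz => ⟨(x, y, z), ⟨hz, rfl, rfl⟩, rfl⟩
    · rintro ⟨⟨x', y', z'⟩, ⟨hz, rfl, rfl⟩, rfl⟩
      exact hz
  rw [h]
  refine ((isCompact_A n).inter_right ?_).image (by fun_prop)
  exact (isClosed_eq (by fun_prop) (by fun_prop)).inter (isClosed_eq (by fun_prop) (by fun_prop))

theorem exists_mem_upperShell {n : ℕ} (hn : 2 ≤ n) {x y : ℝ} (h : (x, y) ∈ flatRegion n) :
    ∃ z, (x, y, z) ∈ upperShell n ∧ ∀ w, (x, y, w) ∈ A n → w ≤ z := by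
  obtain ⟨t, z, ht⟩ := exists_represents (by omega) h
  obtain ⟨m, hm, hmax⟩ := (isCompact_fiber n x y).exists_isGreatest ⟨z, mem_A_iff.2 ⟨t, ht⟩⟩
  obtain ⟨t', ht'⟩ := mem_A_iff.1 hm
  refine ⟨m, ht'.mem_upperShell hn ?_, fun w hw => hmax hw⟩
  by_contra hu
  obtain ⟨δ, hδ, H⟩ := ht'.exists_raise hu
  linarith [hmax (H δ hδ le_rfl)]

theorem le_of_mem_upperShell {n : ℕ} (hn : 2 ≤ n) {x y z w : ℝ} (h : (x, y, z) ∈ upperShell n)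
    (hw : (x, y, w) ∈ A n) : w ≤ z := by
  obtain ⟨t, ht⟩ := mem_A_iff.1 hw
  obtain ⟨m, hm, hmax⟩ := exists_mem_upperShell hn ht.mem_flatRegion
  rw [upperShell_unique h hm]
  exact hmax w hw

theorem Represents.isUpper {n : ℕ} (hn : 2 ≤ n) {t : Fin n → ℝ} {x y z : ℝ}
    (h : Represents t x y z) (hz : (x, y, z) ∈ upperShell n) : IsUpper t := by
  by_contra hu
  obtain ⟨δ, hδ, H⟩ := h.exists_raise hu
  linarith [le_of_mem_upperShell hn hz (H δ hδ le_rfl)]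

/-- Below its top, a fibre has no gaps: a tuple that is not at the top can be raised by every
sufficiently small amount. -/
theorem mem_A_of_le_of_le {n : ℕ} (hn : 2 ≤ n) {x y z₀ z z₁ : ℝ} (h₀ : (x, y, z₀) ∈ A n)
    (h₁ : (x, y, z₁) ∈ upperShell n) (hz₀ : z₀ ≤ z) (hz₁ : z ≤ z₁) : (x, y, z) ∈ A n := by
  have hsub : Icc z₀ z₁ ⊆ {z : ℝ | (x, y, z) ∈ A n} := by
    refine IsClosed.Icc_subset_of_forall_exists_gt
      ((isCompact_fiber n x y).isClosed.inter isClosed_Icc) h₀ ?_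
    rintro w ⟨hw, hw0, hw1⟩ v hv
    obtain ⟨t, ht⟩ := mem_A_iff.1 hw
    have hu : ¬ IsUpper t := fun hu =>
      hw1.ne (upperShell_unique (ht.mem_upperShell hn hu) h₁)
    obtain ⟨δ, hδ, H⟩ := ht.exists_raise hu
    have hvw : 0 < v - w := sub_pos.2 hv
    refine ⟨w + min δ (v - w), H _ (lt_min hδ hvw) (min_le_left _ _), ?_, ?_⟩
    · linarith [lt_min hδ hvw]
    · linarith [min_le_right δ (v - w)]
  exact hsub ⟨hz₀, hz₁⟩

/-- The symmetry `(x, y, z) ↦ (-x, y, -z)` interchanges the two shells. -/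
theorem mem_lowerShell_iff {n : ℕ} {x y z : ℝ} :
    (x, y, z) ∈ lowerShell n ↔ (-x, y, -z) ∈ upperShell n := by
  simp only [upperShell, lowerShell, mem_iUnion, exists_prop]
  refine exists_congr fun k => and_congr_right fun _ => ?_
  simp only [upperRidge, lowerRidge, mem_ofPred_eq, cubic, Prod.ext_iff, Prod.smul_mk,
    Prod.mk_add_mk, smul_eq_mul, mul_one]
  constructor
  · rintro ⟨s, t, h1, h2, h3, e1, e2, e3⟩
    exact ⟨-t, -s, by linarith, by linarith, by linarith, by linarith, by linarith, by linarith⟩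
  · rintro ⟨s, t, h1, h2, h3, e1, e2, e3⟩
    exact ⟨-t, -s, by linarith, by linarith, by linarith, by linarith, by linarith, by linarith⟩

theorem lowerShell_subset_A (n : ℕ) : lowerShell n ⊆ A n := by
  rintro ⟨x, y, z⟩ h
  exact neg_mem_A_iff.1 (upperShell_subset_A n (mem_lowerShell_iff.1 h))

theorem lowerShell_unique {n : ℕ} {x y z z' : ℝ} (h : (x, y, z) ∈ lowerShell n)
    (h' : (x, y, z') ∈ lowerShell n) : z = z' :=
  neg_injective (upperShell_unique (mem_lowerShell_iff.1 h) (mem_lowerShell_iff.1 h'))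

theorem le_of_mem_lowerShell {n : ℕ} (hn : 2 ≤ n) {x y z w : ℝ} (h : (x, y, z) ∈ lowerShell n)
    (hw : (x, y, w) ∈ A n) : z ≤ w :=
  neg_le_neg_iff.1 (le_of_mem_upperShell hn (mem_lowerShell_iff.1 h) (neg_mem_A_iff.2 hw))

theorem exists_mem_lowerShell {n : ℕ} (hn : 2 ≤ n) {x y : ℝ} (h : (x, y) ∈ flatRegion n) :
    ∃ z, (x, y, z) ∈ lowerShell n := by
  obtain ⟨z, hz, -⟩ := exists_mem_upperShell hn (neg_mem_flatRegion (by omega) h)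
  exact ⟨-z, mem_lowerShell_iff.2 (by simpa using hz)⟩

theorem mem_flatRegion_of_mem_A {n : ℕ} {x y z : ℝ} (h : (x, y, z) ∈ A n) :
    (x, y) ∈ flatRegion n := by
  obtain ⟨t, ht⟩ := mem_A_iff.1 h
  exact ht.mem_flatRegion

theorem mem_A_iff_of_mem_shells {n : ℕ} (hn : 2 ≤ n) {x y z zp zm : ℝ}
    (hp : (x, y, zp) ∈ upperShell n) (hm : (x, y, zm) ∈ lowerShell n) :
    (x, y, z) ∈ A n ↔ zm ≤ z ∧ z ≤ zp :=
  ⟨fun h => ⟨le_of_mem_lowerShell hn hm h, le_of_mem_upperShell hn hp h⟩,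
    fun h => mem_A_of_le_of_le hn (lowerShell_subset_A n hm) hp h.1 h.2⟩

theorem proj_image_upperShell {n : ℕ} (hn : 2 ≤ n) : proj '' upperShell n = flatRegion n := by
  ext ⟨x, y⟩
  constructor
  · rintro ⟨⟨x', y', z⟩, h, he⟩
    obtain ⟨rfl, rfl⟩ := Prod.ext_iff.1 he
    exact mem_flatRegion_of_mem_A (upperShell_subset_A n h)
  · intro h
    obtain ⟨z, hz, -⟩ := exists_mem_upperShell hn h
    exact ⟨_, hz, rfl⟩

theorem proj_image_lowerShell {n : ℕ} (hn : 2 ≤ n) : proj '' lowerShell n = flatRegion n := by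
  ext ⟨x, y⟩
  constructor
  · rintro ⟨⟨x', y', z⟩, h, he⟩
    obtain ⟨rfl, rfl⟩ := Prod.ext_iff.1 he
    exact mem_flatRegion_of_mem_A (lowerShell_subset_A n h)
  · intro h
    obtain ⟨z, hz⟩ := exists_mem_lowerShell hn h
    exact ⟨_, hz, rfl⟩

/-! ### The boundary of the planar region -/

/-- One of the quadratic inequalities defining the planar region is an equality at `(x, y)`. -/
def IsTight (n : ℕ) (x y : ℝ) : Prop :=
  x ^ 2 = n * y ∨ ∃ i < n, y = (n : ℝ) - 1 + (x + 2 * (i : ℝ) - ((n : ℝ) - 1)) ^ 2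

theorem isClosed_flatRegion (n : ℕ) : IsClosed (flatRegion n) := by
  have : flatRegion n = {q : ℝ × ℝ | -(n : ℝ) ≤ q.1} ∩ {q | q.1 ≤ n} ∩ {q | q.1 ^ 2 ≤ n * q.2} ∩
      ⋂ i ∈ Finset.range n,
        {q | q.2 ≤ (n : ℝ) - 1 + (q.1 + 2 * (i : ℝ) - ((n : ℝ) - 1)) ^ 2} := by
    ext q
    simp only [flatRegion, mem_ofPred_eq, mem_inter_iff, mem_iInter, and_assoc]
  rw [this]
  refine IsClosed.inter (IsClosed.inter (IsClosed.inter ?_ ?_) ?_)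
    (isClosed_biInter fun i _ => ?_)
  all_goals exact isClosed_le (by fun_prop) (by fun_prop)

theorem mem_interior_flatRegion {n : ℕ} (hn : 1 ≤ n) {x y : ℝ} (h : (x, y) ∈ flatRegion n)
    (ht : ¬ IsTight n x y) : (x, y) ∈ interior (flatRegion n) := by
  obtain ⟨h1, h2, h3, h4⟩ := h
  simp only at h1 h2 h3 h4
  simp only [IsTight, not_or, not_exists, not_and] at ht
  obtain ⟨t3, t4⟩ := ht
  have hn0 : (0 : ℝ) < n := by exact_mod_cast hn
  let U : Set (ℝ × ℝ) := {q : ℝ × ℝ | -(n : ℝ) < q.1} ∩ {q | q.1 < n} ∩ {q | q.1 ^ 2 < n * q.2} ∩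
      ⋂ i ∈ Finset.range n,
        {q | q.2 < (n : ℝ) - 1 + (q.1 + 2 * (i : ℝ) - ((n : ℝ) - 1)) ^ 2}
  have hU : IsOpen U := by
    refine IsOpen.inter (IsOpen.inter (IsOpen.inter ?_ ?_) ?_)
      (isOpen_biInter_finset fun i _ => ?_)
    all_goals exact isOpen_lt (by fun_prop) (by fun_prop)
  refine mem_interior.2 ⟨U, ?_, hU, ⟨⟨⟨?_, ?_⟩, lt_of_le_of_ne h3 t3⟩, ?_⟩⟩
  · rintro q ⟨⟨⟨q1, q2⟩, q3⟩, q4⟩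
    simp only [mem_iInter, mem_ofPred_eq] at q1 q2 q3 q4
    exact ⟨q1.le, q2.le, q3.le, fun i hi => (q4 i hi).le⟩
  · -- at `x = ±n` the bounds on `y` leave only `y = n`, where `x ^ 2 = n * y`
    refine lt_of_le_of_ne h1 ?_
    rintro rfl
    have h5 := h4 (n - 1) (Finset.mem_range.2 (by omega))
    rw [Nat.cast_sub hn] at h5
    push_cast at h5
    refine t3 (le_antisymm h3 ?_)
    nlinarith
  · refine lt_of_le_of_ne h2 ?_
    rintro rfl
    have h5 := h4 0 (Finset.mem_range.2 (by omega))
    push_cast at h5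
    refine t3 (le_antisymm h3 ?_)
    nlinarith
  · simp only [mem_iInter, mem_ofPred_eq]
    exact fun i hi => lt_of_le_of_ne (h4 i hi) (t4 i (Finset.mem_range.1 hi))

theorem IsTight.notMem_interior {n : ℕ} (hn : 1 ≤ n) {x y : ℝ} (ht : IsTight n x y) :
    (x, y) ∉ interior (flatRegion n) := by
  intro h
  have hc : Continuous fun r : ℝ => (x, r) := by fun_prop
  have hnhds : (fun r : ℝ => (x, r)) ⁻¹' flatRegion n ∈ nhds y :=
    hc.continuousAt.preimage_mem_nhds (mem_interior_iff_mem_nhds.1 h)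
  obtain ⟨ε, hε, hball⟩ := Metric.mem_nhds_iff.1 hnhds
  rcases ht with ht | ⟨i, hi, ht⟩
  · have h1 : (x, y - ε / 2) ∈ flatRegion n := hball (by
      rw [Metric.mem_ball, Real.dist_eq, abs_lt]
      constructor <;> linarith)
    have h2 := h1.2.2.1
    have hn0 : (0 : ℝ) < n := by exact_mod_cast hn
    simp only at h2
    nlinarith
  · have h1 : (x, y + ε / 2) ∈ flatRegion n := hball (by
      rw [Metric.mem_ball, Real.dist_eq, abs_lt]
      constructor <;> linarith)
    have h2 := h1.2.2.2 i (Finset.mem_range.2 hi)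
    simp only at h2
    linarith

theorem mem_frontier_flatRegion_iff {n : ℕ} (hn : 1 ≤ n) {x y : ℝ} (h : (x, y) ∈ flatRegion n) :
    (x, y) ∈ frontier (flatRegion n) ↔ IsTight n x y := by
  rw [(isClosed_flatRegion n).frontier_eq]
  exact ⟨fun h' => by_contra fun ht => h'.2 (mem_interior_flatRegion hn h ht),
    fun ht => ⟨h, ht.notMem_interior hn⟩⟩

theorem isUpper_of_abs_eq_one {n : ℕ} {t : Fin n → ℝ} (h0 : ∀ i, t i ∈ Icc (-1 : ℝ) 1)
    (h : ∀ p q, p ≠ q → |t p| = 1 ∨ |t q| = 1) : IsUpper t := by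
  intro i j l _ hjl _ h1 h2
  have hj : -1 < t j := (h0 i).1.trans_lt h1
  rcases h j l hjl with h3 | h3
  · rcases eq_or_eq_neg_of_abs_eq h3 with h4 | h4
    · exact le_antisymm (h0 l).2 (h4 ▸ h2)
    · linarith
  · rcases eq_or_eq_neg_of_abs_eq h3 with h4 | h4
    · exact h4
    · linarith

/-- Over the boundary of the planar region every tuple is extreme in both directions: either it is
constant, or all but one of its entries are `±1`, since otherwise two entries could be moved apart,
keeping `x` and increasing `y`. -/
theorem IsTight.isUpper {n : ℕ} {t : Fin n → ℝ} {x y z : ℝ} (ht : IsTight n x y)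
    (h : Represents t x y z) : IsUpper t ∧ IsUpper (-t) := by
  obtain ⟨h0, rfl, rfl, rfl⟩ := h
  rcases ht with ht | ⟨i, hi, ht⟩
  · have hconst : ∀ p q, t p = t q := by
      intro p q
      have hn0 : (n : ℝ) ≠ 0 := by
        have := p.pos
        positivity
      set m := (∑ i, t i) / n with hm
      have h1 : ∑ i, (t i - m) ^ 2 = 0 := by
        have : ∑ i, (t i - m) ^ 2 = ∑ i, t i ^ 2 - 2 * m * ∑ i, t i + n * m ^ 2 := by
          simp only [sub_sq, Finset.sum_add_distrib, Finset.sum_sub_distrib, Finset.mul_sum]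
          simp only [Finset.sum_const, Finset.card_univ, Fintype.card_fin, nsmul_eq_mul]
          congr 2
          exact Finset.sum_congr rfl fun i _ => by ring
        rw [this, show ∑ i, t i = n * m by rw [hm]; field_simp]
        rw [show ∑ i, t i = n * m by rw [hm]; field_simp] at ht
        apply mul_left_cancel₀ hn0
        linear_combination -ht
      have h2 := (Finset.sum_eq_zero_iff_of_nonneg fun i _ => sq_nonneg (t i - m)).1 h1
      have hp := pow_eq_zero_iff two_ne_zero |>.1 (h2 p (Finset.mem_univ p))
      have hq := pow_eq_zero_iff two_ne_zero |>.1 (h2 q (Finset.mem_univ q))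
      linarith
    exact ⟨fun i j _ _ _ _ hlt => absurd (hconst i j) hlt.ne,
      fun i j _ _ _ _ hlt => absurd (congrArg Neg.neg (hconst i j)) hlt.ne⟩
  · have key : ∀ p q, p ≠ q → t p ≤ t q → |t p| = 1 ∨ |t q| = 1 := by
      intro p q hpq hle
      by_contra! hne
      have hp : -1 < t p := lt_of_le_of_ne (h0 p).1 fun he => hne.1 (by rw [← he]; simp)
      have hq : t q < 1 := lt_of_le_of_ne (h0 q).2 fun he => hne.2 (by rw [he]; simp)
      let δ := min (t p + 1) (1 - t q)
      have hδ : 0 < δ := lt_min (by linarith) (by linarith)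
      have hδp : δ ≤ t p + 1 := min_le_left _ _
      have hδq : δ ≤ 1 - t q := min_le_right _ _
      have hs := fun f : ℝ → ℝ => sum_update f (Function.update t p (t p - δ)) q (t q + δ)
      simp only [sum_update _ t, Function.update_of_ne hpq.symm] at hs
      have h1 := sum_sq_le (Function.update (Function.update t p (t p - δ)) q (t q + δ))
        (fun m => by
          simp only [Function.update_apply]
          split_ifs
          exacts [⟨by linarith, by linarith⟩, ⟨by linarith [(h0 p).1], by linarith [(h0 p).2]⟩,
            h0 m]) i
      rw [hs fun r => r, hs fun r => r ^ 2] at h1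
      rw [show ∑ m, t m + (t p - δ - t p) + (t q + δ - t q) = ∑ m, t m by ring, ← ht] at h1
      nlinarith [mul_nonneg hδ.le (sub_nonneg.2 hle), mul_pos hδ hδ]
    have key' : ∀ p q, p ≠ q → |t p| = 1 ∨ |t q| = 1 := fun p q hpq =>
      (le_total (t p) (t q)).elim (key p q hpq) fun hle => (key q p hpq.symm hle).symm
    refine ⟨isUpper_of_abs_eq_one h0 key', isUpper_of_abs_eq_one (fun i => ?_) fun p q hpq => ?_⟩
    · simp only [Pi.neg_apply]
      exact ⟨by linarith [(h0 i).2], by linarith [(h0 i).1]⟩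
    · simpa using key' p q hpq

/-- An upper tuple whose negative is extreme as well is constant or has all but one entry equal to
`±1`, so its first two power sums lie on the boundary of the planar region. -/
theorem isTight_of_isUpper_neg {n k : ℕ} (hn : 3 ≤ n) (hk : 1 ≤ k) (hkn : k < n) {s u x y z : ℝ}
    (hs : -1 ≤ s) (hsu : s ≤ u) (hu : u ≤ 1) (h : Represents (upperTuple n k s u) x y z)
    (hneg : IsUpper (-upperTuple n k s u)) : IsTight n x y := by
  rw [upperTuple_represents_iff hkn hs hsu hu] at h
  obtain ⟨rfl, rfl, -⟩ := h
  have hneg' : ∀ (i j l : ℕ) (hi : i < n) (hj : j < n) (hl : l < n), i ≠ j → j ≠ l → i ≠ l →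
      upperTuple n k s u ⟨j, hj⟩ < upperTuple n k s u ⟨i, hi⟩ →
      upperTuple n k s u ⟨l, hl⟩ ≤ upperTuple n k s u ⟨j, hj⟩ →
      upperTuple n k s u ⟨l, hl⟩ = -1 := by
    intro i j l hi hj hl h1 h2 h3 h4 h5
    have := hneg ⟨i, hi⟩ ⟨j, hj⟩ ⟨l, hl⟩ (by simpa using h1) (by simpa using h2) (by simpa using h3)
      (neg_lt_neg h4) (neg_le_neg h5)
    simp only [Pi.neg_apply] at this
    linarith
  simp only [upperTuple] at hneg'
  have tight_of_eq : s = -1 → IsTight n (k * s + u + ((n : ℝ) - k - 1))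
      (k * s ^ 2 + u ^ 2 + ((n : ℝ) - k - 1)) := by
    rintro rfl
    exact Or.inr ⟨k, hkn, by ring⟩
  rcases hk.eq_or_lt with rfl | hk2
  · rcases hu.eq_or_lt with rfl | hu1
    · exact Or.inr ⟨0, by omega, by push_cast; ring⟩
    · refine tight_of_eq ?_
      simpa using hneg' 2 1 0 (by omega) (by omega) (by omega) (by omega) (by omega) (by omega)
        (by simpa using hu1) (by simpa using hsu)
  · rcases hsu.eq_or_lt with rfl | hlt
    · rcases (show k + 1 ≤ n from hkn).eq_or_lt with rfl | hkn1
      · exact Or.inl (by push_cast; ring)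
      · rcases hu.eq_or_lt with rfl | hu1
        · exact Or.inl (by ring)
        · refine tight_of_eq ?_
          simpa [hk2, show 0 < k by omega] using
            hneg' (k + 1) 0 1 (by omega) (by omega) (by omega) (by omega) (by omega) (by omega)
              (by simpa [show 0 < k by omega] using hu1) (by simp [hk2, show 0 < k by omega])
    · refine tight_of_eq ?_
      simpa [hk2, show 0 < k by omega] using
        hneg' k 0 1 (by omega) (by omega) (by omega) (by omega) (by omega) (by omega)
          (by simpa [show 0 < k by omega] using hlt) (by simp [hk2, show 0 < k by omega])

theorem shells_eq_iff_isTight {n : ℕ} (hn : 3 ≤ n) {x y zp zm : ℝ}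
    (hp : (x, y, zp) ∈ upperShell n) (hm : (x, y, zm) ∈ lowerShell n) :
    zp = zm ↔ IsTight n x y := by
  constructor
  · rintro rfl
    obtain ⟨k, s, u, h1, h2, h3, h4, h5, h⟩ := mem_upperShell_iff.1 hp
    exact isTight_of_isUpper_neg hn h1 h2 h3 h4 h5 h
      (h.neg.isUpper (by omega) (mem_lowerShell_iff.1 hm))
  · intro ht
    obtain ⟨t, h⟩ := mem_A_iff.1 (upperShell_subset_A n hp)
    refine lowerShell_unique (mem_lowerShell_iff.2 ?_) hm
    exact h.neg.mem_upperShell (by omega) (ht.isUpper h).2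

/-! ### The boundary of the Minkowski sum -/

theorem isCompact_upperShell (n : ℕ) : IsCompact (upperShell n) := by
  refine (Finset.Icc 1 (n - 1)).isCompact_biUnion fun k _ => ?_
  have h : upperRidge k (n - k - 1) =
      (fun q : ℝ × ℝ => (k : ℝ) • cubic q.1 + cubic q.2 +
        ((n - k - 1 : ℕ) : ℝ) • ((1, 1, 1) : ℝ × ℝ × ℝ)) ''
      ((Icc (-1) 1 ×ˢ Icc (-1) 1) ∩ {q | q.1 ≤ q.2}) := by
    ext p
    constructor
    · rintro ⟨s, t, h1, h2, h3, rfl⟩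
      exact ⟨(s, t), ⟨⟨⟨h1, h2.trans h3⟩, h1.trans h2, h3⟩, h2⟩, rfl⟩
    · rintro ⟨⟨s, t⟩, ⟨⟨⟨h1, -⟩, -, h3⟩, h2⟩, rfl⟩
      exact ⟨s, t, h1, h2, h3, rfl⟩
  rw [h]
  have := continuous_cubic
  refine ((isCompact_Icc.prod isCompact_Icc).inter_right
    (isClosed_le (by fun_prop) (by fun_prop))).image (by fun_prop)

theorem isCompact_lowerShell (n : ℕ) : IsCompact (lowerShell n) := by
  have h : lowerShell n = (fun p : ℝ × ℝ × ℝ => (-p.1, p.2.1, -p.2.2)) '' upperShell n := by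
    ext ⟨x, y, z⟩
    rw [mem_lowerShell_iff]
    constructor
    · exact fun h => ⟨_, h, by simp⟩
    · rintro ⟨⟨x', y', z'⟩, h, he⟩
      simp only [Prod.ext_iff] at he
      obtain ⟨rfl, rfl, rfl⟩ := he
      simpa using h
  rw [h]
  exact (isCompact_upperShell n).image (by fun_prop)

/-- Away from the shells, points of the Minkowski sum are interior. As the shells are compact, the
planar points over which the upper shell descends to height `b > z` form a closed set, and likewise
for the lower shell; both sets avoid `(x, y)`. -/
theorem mem_interior_A {n : ℕ} (hn : 3 ≤ n) {x y z : ℝ} (h : (x, y, z) ∈ A n)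
    (hu : (x, y, z) ∉ upperShell n) (hl : (x, y, z) ∉ lowerShell n) :
    (x, y, z) ∈ interior (A n) := by
  have hn2 : 2 ≤ n := by omega
  have hflat := mem_flatRegion_of_mem_A h
  obtain ⟨zp, hp, hpmax⟩ := exists_mem_upperShell hn2 hflat
  obtain ⟨zm, hm⟩ := exists_mem_lowerShell hn2 hflat
  have hzp : z < zp := lt_of_le_of_ne (hpmax z h) (by rintro rfl; exact hu hp)
  have hzm : zm < z := lt_of_le_of_ne (le_of_mem_lowerShell hn2 hm h) (by rintro rfl; exact hl hm)
  obtain ⟨b, hzb, hbp⟩ := exists_between hzp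
  obtain ⟨a, hma, haz⟩ := exists_between hzm
  have hint : (x, y) ∈ interior (flatRegion n) := by
    refine mem_interior_flatRegion (by omega) hflat fun ht => ?_
    exact (hzm.trans hzp).ne' ((shells_eq_iff_isTight hn hp hm).2 ht)
  have hproj : Continuous proj := by unfold proj; fun_prop
  have hU : IsClosed (proj '' (upperShell n ∩ {p | p.2.2 ≤ b})) :=
    (((isCompact_upperShell n).inter_right
      (isClosed_le (by fun_prop) (by fun_prop))).image hproj).isClosed
  have hL : IsClosed (proj '' (lowerShell n ∩ {p | a ≤ p.2.2})) :=
    (((isCompact_lowerShell n).inter_right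
      (isClosed_le (by fun_prop) (by fun_prop))).image hproj).isClosed
  let V : Set (ℝ × ℝ × ℝ) := proj ⁻¹' (interior (flatRegion n) ∩
      (proj '' (upperShell n ∩ {p | p.2.2 ≤ b}))ᶜ ∩ (proj '' (lowerShell n ∩ {p | a ≤ p.2.2}))ᶜ) ∩
      ({p | a < p.2.2} ∩ {p | p.2.2 < b})
  refine mem_interior.2 ⟨V, ?_, ?_, ⟨⟨hint, ?_⟩, ?_⟩, haz, hzb⟩
  · rintro ⟨x', y', w⟩ ⟨⟨⟨h1, h2⟩, h3⟩, h4, h5⟩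
    simp only [mem_ofPred_eq] at h4 h5
    have hflat' : (x', y') ∈ flatRegion n := interior_subset h1
    obtain ⟨wp, hwp, -⟩ := exists_mem_upperShell hn2 hflat'
    obtain ⟨wm, hwm⟩ := exists_mem_lowerShell hn2 hflat'
    rw [mem_A_iff_of_mem_shells hn2 hwp hwm]
    constructor
    · by_contra! hlt
      exact h3 ⟨_, ⟨hwm, (h4.trans hlt).le⟩, rfl⟩
    · by_contra! hlt
      exact h2 ⟨_, ⟨hwp, (hlt.trans h5).le⟩, rfl⟩
  · exact (((isOpen_interior.inter hU.isOpen_compl).inter hL.isOpen_compl).preimage hproj).inter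
      ((isOpen_lt (by fun_prop) (by fun_prop)).inter (isOpen_lt (by fun_prop) (by fun_prop)))
  · rintro ⟨⟨x', y', w⟩, ⟨h1, h2⟩, he⟩
    obtain ⟨rfl, rfl⟩ := Prod.ext_iff.1 he
    obtain rfl := upperShell_unique h1 hp
    exact hbp.not_ge h2
  · rintro ⟨⟨x', y', w⟩, ⟨h1, h2⟩, he⟩
    obtain ⟨rfl, rfl⟩ := Prod.ext_iff.1 he
    obtain rfl := lowerShell_unique h1 hm
    exact hma.not_ge h2

/-- An interior point of `A n` can be moved up and down inside `A n`. -/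
theorem exists_vertical_of_mem_interior {n : ℕ} {x y z : ℝ} (h : (x, y, z) ∈ interior (A n)) :
    ∃ δ > 0, (x, y, z + δ) ∈ A n ∧ (x, y, z - δ) ∈ A n := by
  have hc : Continuous fun r : ℝ => (x, y, r) := by fun_prop
  have hnhds : (fun r : ℝ => (x, y, r)) ⁻¹' A n ∈ nhds z :=
    hc.continuousAt.preimage_mem_nhds (mem_interior_iff_mem_nhds.1 h)
  obtain ⟨ε, hε, hball⟩ := Metric.mem_nhds_iff.1 hnhds
  refine ⟨ε / 2, by positivity, hball ?_, hball ?_⟩ <;>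
  · rw [Metric.mem_ball, Real.dist_eq, abs_lt]
    constructor <;> linarith

theorem frontier_A {n : ℕ} (hn : 3 ≤ n) : frontier (A n) = upperShell n ∪ lowerShell n := by
  rw [(isCompact_A n).isClosed.frontier_eq]
  ext ⟨x, y, z⟩
  constructor
  · rintro ⟨h1, h2⟩
    by_contra h3
    simp only [mem_union, not_or] at h3
    exact h2 (mem_interior_A hn h1 h3.1 h3.2)
  · rintro (h | h)
    · refine ⟨upperShell_subset_A n h, fun h' => ?_⟩
      obtain ⟨δ, hδ, h1, -⟩ := exists_vertical_of_mem_interior h'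
      linarith [le_of_mem_upperShell (by omega) h h1]
    · refine ⟨lowerShell_subset_A n h, fun h' => ?_⟩
      obtain ⟨δ, hδ, -, h1⟩ := exists_vertical_of_mem_interior h'
      linarith [le_of_mem_lowerShell (by omega) h h1]

/-! ### Uniqueness of representations on the boundary -/

theorem exists_unique_tuple_upperShell {n : ℕ} (hn : 2 ≤ n) {x y z : ℝ}
    (h : (x, y, z) ∈ upperShell n) : ∃ t : Fin n → ℝ, Represents t x y z ∧
      (range t \ {-1, 1}).encard ≤ 2 ∧
      ∀ v : Fin n → ℝ, Represents v x y z → ∃ σ : Equiv.Perm (Fin n), ∀ i, v i = t (σ i) := by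
  obtain ⟨k, s, u, h1, h2, h3, h4, h5, ht⟩ := mem_upperShell_iff.1 h
  refine ⟨upperTuple n k s u, ht, ?_, fun v hv => ?_⟩
  · have hpair : ({s, u} : Set ℝ).encard ≤ 2 :=
      (encard_insert_le _ _).trans (by rw [encard_singleton, one_add_one_eq_two])
    refine (encard_le_encard ?_).trans hpair
    rintro _ ⟨⟨i, rfl⟩, hi⟩
    simp only [upperTuple] at hi ⊢
    split_ifs at hi ⊢ <;> simp_all
  · obtain ⟨σ, k', s', u', h1', h2', h3', h4', h5', hσ⟩ := (hv.isUpper hn h).exists_perm hn hv.1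
    have he := upperTuple_unique h1 h2 h3 h4 h5 h1' h2' h3' h4' h5' ht (hσ ▸ hv.comp_perm σ)
    refine ⟨σ⁻¹, fun i => ?_⟩
    rw [he, ← hσ]
    simp

theorem exists_unique_tuple_lowerShell {n : ℕ} (hn : 2 ≤ n) {x y z : ℝ}
    (h : (x, y, z) ∈ lowerShell n) : ∃ t : Fin n → ℝ, Represents t x y z ∧
      (range t \ {-1, 1}).encard ≤ 2 ∧
      ∀ v : Fin n → ℝ, Represents v x y z → ∃ σ : Equiv.Perm (Fin n), ∀ i, v i = t (σ i) := by
  obtain ⟨t, h1, h2, h3⟩ := exists_unique_tuple_upperShell hn (mem_lowerShell_iff.1 h)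
  refine ⟨-t, by simpa using h1.neg, ?_, fun v hv => ?_⟩
  · have : range (-t) \ {-1, 1} = Neg.neg '' (range t \ {-1, 1}) := by
      rw [image_sdiff neg_injective, ← range_comp, image_pair, neg_neg, pair_comm]
      rfl
    rw [this]
    exact (encard_image_le _ _).trans h2
  · obtain ⟨σ, hσ⟩ := h3 (-v) hv.neg
    exact ⟨σ, fun i => by simpa [neg_eq_iff_eq_neg] using hσ i⟩

end MomentCurve

theorem mainTheorem2 (n : ℕ) (hn : 3 ≤ n) :
    -- (a)
    frontier (MomentCurve.A n) = MomentCurve.upperShell n ∪ MomentCurve.lowerShell n ∧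
    -- (b)
    (MomentCurve.proj '' MomentCurve.upperShell n = MomentCurve.flatRegion n ∧
      MomentCurve.proj '' MomentCurve.lowerShell n = MomentCurve.flatRegion n) ∧
    -- (c), (d)
    (∀ x y : ℝ, (x, y) ∈ MomentCurve.flatRegion n →
      ∃ zp zm : ℝ,
        ((x, y, zp) ∈ MomentCurve.upperShell n ∧
          ∀ w : ℝ, (x, y, w) ∈ MomentCurve.upperShell n → w = zp) ∧
        ((x, y, zm) ∈ MomentCurve.lowerShell n ∧
          ∀ w : ℝ, (x, y, w) ∈ MomentCurve.lowerShell n → w = zm) ∧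
        zm ≤ zp ∧
        (zp = zm ↔ (x, y) ∈ frontier (MomentCurve.flatRegion n)) ∧
        ∀ z : ℝ, (x, y, z) ∈ MomentCurve.A n ↔ zm ≤ z ∧ z ≤ zp) ∧
    -- (e)
    (∀ p ∈ frontier (MomentCurve.A n),
      ∃ t : Fin n → ℝ,
        (∀ i, t i ∈ Set.Icc (-1 : ℝ) 1) ∧
        p = ∑ i, MomentCurve.cubic (t i) ∧
        (Set.range t \ {-1, 1}).encard ≤ 2 ∧
        ∀ u : Fin n → ℝ, (∀ i, u i ∈ Set.Icc (-1 : ℝ) 1) →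
          p = ∑ i, MomentCurve.cubic (u i) →
          ∃ σ : Equiv.Perm (Fin n), ∀ i, u i = t (σ i)) := by
  refine ⟨MomentCurve.frontier_A hn, ⟨MomentCurve.proj_image_upperShell (by omega),
    MomentCurve.proj_image_lowerShell (by omega)⟩,
    fun x y hxy => ?_, ?_⟩
  · obtain ⟨zp, hp, -⟩ := MomentCurve.exists_mem_upperShell (by omega) hxy
    obtain ⟨zm, hm⟩ := MomentCurve.exists_mem_lowerShell (by omega) hxy
    refine ⟨zp, zm, ⟨hp, fun w hw => MomentCurve.upperShell_unique hw hp⟩,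
      ⟨hm, fun w hw => MomentCurve.lowerShell_unique hw hm⟩,
      MomentCurve.le_of_mem_lowerShell (by omega) hm (MomentCurve.upperShell_subset_A n hp), ?_,
      fun z => MomentCurve.mem_A_iff_of_mem_shells (by omega) hp hm⟩
    rw [MomentCurve.mem_frontier_flatRegion_iff (by omega) hxy,
      MomentCurve.shells_eq_iff_isTight hn hp hm]
  · rintro ⟨x, y, z⟩ h
    rw [MomentCurve.frontier_A hn] at h
    obtain ⟨t, h1, h2, h3⟩ := h.elim (MomentCurve.exists_unique_tuple_upperShell (by omega))
      (MomentCurve.exists_unique_tuple_lowerShell (by omega))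
    rw [MomentCurve.represents_iff] at h1
    exact ⟨t, h1.1, h1.2, h2, fun u hu hpu => h3 u (MomentCurve.represents_iff.2 ⟨hu, hpu⟩)⟩
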